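/- All graphs are finite and simple. A pebbling distribution on a graph $G$ is a function $D:V(G)\to\mathbb{Z}_{\ge 0}$, and its size is $\sum_{x}D(x)$. A pebbling move removes two pebbles from a vertex that has at least two pebbles and places one pebble on an adjacent vertex. A vertex is reachable under $D$ if some (possibly empty) sequence of pebbling moves starting from $D$ ends with at least one pebble on it. The optimal pebbling number $\pi^*(G)$ is the smallest size of a distribution under which every vertex of $G$ is reachable. A set $S$ of vertices dominates $G$ if every vertex of $G$ lies in $S$ or is adjacent to a vertex of $S$; an edge is dominating if the set of its two endpoints dominates $G$. A graph $H$ is special if it has diameter two, has no dominating edge, and has a special pair, that is, two vertices $u,v$ such that (a) the distance between $u$ and $v$ is two; (b) neither $H-u$ nor $H-v$ has a dominating edge; (c) $(N(u)\cap N(v))\cup\{u,v\}$ dominates $H$. Let $H_1,\dots,H_l$ be (not necessarily isomorphic) special graphs with pairwise disjoint vertex sets, let $(u_i,v_i)$ be a special pair of $H_i$, and let $G_l$ be the graph obtained from the disjoint union of $H_1,\dots,H_l$ by adding the edge $\{v_i,u_{i+1}\}$ for each $1\le i\le l-1$. Then $\pi^*(G_l)\ge \frac{8}{3}l$. Moreover,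 if $l=3k$ for an integer $k$, then $\pi^*(G_{3k})=8k$. -/

import Mathlib

namespace Pebbling

/-- `PebblingMove G D D'`: the distribution `D'` arises from `D` by one allowed pebbling move of `G`,
which removes two pebbles from a vertex `a` and places one pebble on a neighbour `b` of `a`.
(The equation `D a = D' a + 2` forces `a` to have at least two pebbles under `D`.) -/
def PebblingMove {V : Type*} (G : SimpleGraph V) (D D' : V → ℕ) : Prop :=
  ∃ a b, G.Adj a b ∧ D a = D' a + 2 ∧ D' b = D b + 1 ∧ ∀ w, w ≠ a → w ≠ b → D' w = D w

/-- The vertex `v` is reachable under `D`: some finite (possibly empty) sequence of allowed pebbling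
moves starting at `D` ends with at least one pebble at `v`. -/
def Reachable {V : Type*} (G : SimpleGraph V) (D : V → ℕ) (v : V) : Prop :=
  ∃ D', Relation.ReflTransGen (PebblingMove G) D D' ∧ 1 ≤ D' v

/-- A distribution is solvable when every vertex is reachable under it. -/
def Solvable {V : Type*} (G : SimpleGraph V) (D : V → ℕ) : Prop :=
  ∀ v, Reachable G D v

/-- The optimal pebbling number `π*(G)`: the smallest size of a solvable distribution. -/
noncomputable def optimalPebblingNumber {V : Type*} [Fintype V] (G : SimpleGraph V) : ℕ :=
  sInf {n | ∃ D : V → ℕ, Solvable G D ∧ ∑ v, D v = n}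

/-- The infimum in the definition of `π*(G)` is a minimum. -/
theorem optimalPebblingNumber_isLeast {V : Type*} [Fintype V] (G : SimpleGraph V) :
    IsLeast {n | ∃ D : V → ℕ, Solvable G D ∧ ∑ v, D v = n} (optimalPebblingNumber G) := by
  have h : {n | ∃ D : V → ℕ, Solvable G D ∧ ∑ v, D v = n}.Nonempty :=
    ⟨_, fun _ => 1, fun _ => ⟨_, Relation.ReflTransGen.refl, le_rfl⟩, rfl⟩
  exact ⟨Nat.sInf_mem h, fun _ hn => Nat.sInf_le hn⟩

/-- `S` is a dominating set of `G`: each vertex is in `S` or adjacent to a vertex in `S`. -/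
def IsDominatingSet {V : Type*} (G : SimpleGraph V) (S : Set V) : Prop :=
  ∀ w, w ∈ S ∨ ∃ s ∈ S, G.Adj s w

/-- `G` has an edge whose two endpoints form a dominating set. -/
def HasDominatingEdge {V : Type*} (G : SimpleGraph V) : Prop :=
  ∃ a b, G.Adj a b ∧ IsDominatingSet G {a, b}

/-- The graph obtained from `G` by removing the vertex `x`. -/
abbrev removeVertex {V : Type*} (G : SimpleGraph V) (x : V) : SimpleGraph ({x}ᶜ : Set V) :=
  G.induce ({x}ᶜ : Set V)

/-- `u`, `v` have the three properties required of a special pair of `H`. -/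
structure IsSpecialPair {V : Type*} (H : SimpleGraph V) (u v : V) : Prop where
  dist_eq_two : H.dist u v = 2
  not_dominatingEdge_remove_left : ¬ HasDominatingEdge (removeVertex H u)
  not_dominatingEdge_remove_right : ¬ HasDominatingEdge (removeVertex H v)
  isDominatingSet : IsDominatingSet H ((H.neighborSet u ∩ H.neighborSet v) ∪ {u, v})

/-- `H` is special: diameter two, no dominating edge, and there is a special pair. -/
structure IsSpecial {V : Type*} (H : SimpleGraph V) : Prop where
  diam_eq_two : H.diam = 2
  not_dominatingEdge : ¬ HasDominatingEdge H
  exists_specialPair : ∃ u v, IsSpecialPair H u v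

/-- Adjacency in the chain of the graphs `H 0, …, H (l - 1)`, on the disjoint union of their vertex
sets: the edges inside the blocks, and for `j = i + 1` the edge between `v i` and `u j`. -/
inductive ChainAdj {l : ℕ} {B : Fin l → Type*} (H : ∀ i, SimpleGraph (B i)) (u v : ∀ i, B i) :
    (Σ i, B i) → (Σ i, B i) → Prop
  | block (i : Fin l) (x y : B i) (h : (H i).Adj x y) : ChainAdj H u v ⟨i, x⟩ ⟨i, y⟩
  | forward (i j : Fin l) (h : (j : ℕ) = i + 1) : ChainAdj H u v ⟨i, v i⟩ ⟨j, u j⟩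
  | backward (i j : Fin l) (h : (j : ℕ) = i + 1) : ChainAdj H u v ⟨j, u j⟩ ⟨i, v i⟩

/-- The chain `G_l`: the graphs `H 0, …, H (l - 1)` joined sequentially by edges `v i — u (i + 1)`. -/
def chain {l : ℕ} {B : Fin l → Type*} (H : ∀ i, SimpleGraph (B i)) (u v : ∀ i, B i) :
    SimpleGraph (Σ i, B i) where
  Adj := ChainAdj H u v
  symm := ⟨by
    rintro _ _ (⟨i, x, y, h⟩ | ⟨i, j, h⟩ | ⟨i, j, h⟩)
    · exact .block i y x h.symm
    · exact .backward i j h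
    · exact .forward i j h⟩
  loopless := ⟨by
    have key : ∀ p q, ChainAdj H u v p q → p ≠ q := by
      rintro _ _ (⟨i, x, y, h⟩ | ⟨i, j, h⟩ | ⟨i, j, h⟩) hpq
      · exact h.ne (eq_of_heq (Sigma.mk.inj hpq).2)
      · have : i = j := (Sigma.mk.inj hpq).1
        subst this
        omega
      · have : j = i := (Sigma.mk.inj hpq).1
        subst this
        omega
    exact fun p hp => key p p hp rfl⟩

end Pebbling

/-! Upper bound: in each run of three blocks put four pebbles on `v` of the first and four on `u` of
the third. Diameter two covers the outer blocks; the middle one receives two pebbles at each of `u`,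
`v`, and these either reach a neighbour directly or meet on a common neighbour, so condition (c)
covers it.

Lower bound: forget the order of the moves and keep only their numbers (`exists_isChainFlow`).
Weighting pebbles by their distance to the exit bounds the net flow across each connecting edge in
either direction (`right_le`, `left_le`), independently of the target vertex. Adding these bounds to
a block's own pebbles yields a distribution that reaches the whole block, so it has size at least 4
(`IsSpecial.four_le_sum`). An integer inequality (`eight_add_div_le`) turns this into a local bound
whose boundary terms telescope to 8l ≤ 3|D|. -/

namespace Pebbling

/-! ### Explicit move sequences -/

section Reaching

variable {V : Type*} {G : SimpleGraph V}

theorem PebblingMove.add_right {D D' : V → ℕ} (h : PebblingMove G D D') (C : V → ℕ) :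
    PebblingMove G (D + C) (D' + C) := by
  obtain ⟨a, b, hab, h1, h2, h3⟩ := h
  refine ⟨a, b, hab, ?_, ?_, fun w hwa hwb => ?_⟩
  · simp only [Pi.add_apply]; omega
  · simp only [Pi.add_apply]; omega
  · simp only [Pi.add_apply, h3 w hwa hwb]

theorem reflTransGen_add_right {D D' : V → ℕ} (h : Relation.ReflTransGen (PebblingMove G) D D')
    (C : V → ℕ) : Relation.ReflTransGen (PebblingMove G) (D + C) (D' + C) :=
  h.lift (· + C) fun _ _ hm => hm.add_right C

theorem reflTransGen_add {D D' C C' : V → ℕ} (h : Relation.ReflTransGen (PebblingMove G) D D')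
    (h' : Relation.ReflTransGen (PebblingMove G) C C') :
    Relation.ReflTransGen (PebblingMove G) (D + C) (D' + C') := by
  refine (reflTransGen_add_right h C).trans ?_
  rw [add_comm D', add_comm D']
  exact reflTransGen_add_right h' D'

/-- The surplus `D - E` is carried along untouched. -/
theorem Reachable.of_le {D E E' : V → ℕ} {x : V} (hE : E ≤ D)
    (h : Relation.ReflTransGen (PebblingMove G) E E') (hx : 1 ≤ E' x) : Reachable G D x := by
  refine ⟨E' + (D - E), ?_, ?_⟩
  · conv => arg 2; rw [← add_tsub_cancel_of_le hE]
    exact reflTransGen_add_right h _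
  · simp only [Pi.add_apply]; omega

variable [DecidableEq V]

theorem pebblingMove_single {a b : V} (h : G.Adj a b) :
    PebblingMove G (Pi.single a 2) (Pi.single b 1) := by
  refine ⟨a, b, h, ?_, ?_, fun w hwa hwb => ?_⟩
  · simp [h.ne]
  · simp [h.ne']
  · simp [hwa, hwb]

theorem reflTransGen_single_two {a b : V} (h : G.Adj a b) :
    Relation.ReflTransGen (PebblingMove G) (Pi.single a 2) (Pi.single b 1) :=
  .single (pebblingMove_single h)

theorem reflTransGen_single_four {a b : V} (h : G.Adj a b) :
    Relation.ReflTransGen (PebblingMove G) (Pi.single a 4) (Pi.single b 2) := by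
  have := reflTransGen_add (reflTransGen_single_two h) (reflTransGen_single_two h)
  rwa [← Pi.single_add, ← Pi.single_add] at this

theorem single_le_of_le {D : V → ℕ} {a : V} {n : ℕ} (h : n ≤ D a) : Pi.single a n ≤ D := by
  intro w
  by_cases hw : w = a
  · subst hw; simpa using h
  · simp [hw]

theorem reachable_of_two_le {D : V → ℕ} {a x : V} (h : 2 ≤ D a) (hx : x = a ∨ G.Adj a x) :
    Reachable G D x := by
  obtain rfl | hx := hx
  · exact ⟨D, .refl, by omega⟩
  · exact .of_le (single_le_of_le h) (reflTransGen_single_two hx) (by simp)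

theorem reachable_of_four_le {D : V → ℕ} {a b x : V} (h : 4 ≤ D a) (hab : G.Adj a b)
    (hx : x = b ∨ G.Adj b x) : Reachable G D x := by
  obtain rfl | hx := hx
  · exact reachable_of_two_le (by omega) (.inr hab)
  · exact .of_le (single_le_of_le h)
      ((reflTransGen_single_four hab).trans (reflTransGen_single_two hx)) (by simp)

theorem reachable_of_four_le_of_four_le {D : V → ℕ} {p q a b w x : V} (hpq : p ≠ q)
    (hp : 4 ≤ D p) (hq : 4 ≤ D q) (hpa : G.Adj p a) (hqb : G.Adj q b) (haw : G.Adj a w)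
    (hbw : G.Adj b w) (hwx : G.Adj w x) : Reachable G D x := by
  have hE : Pi.single p 4 + Pi.single q 4 ≤ D := by
    intro z
    by_cases h1 : z = p
    · subst h1; simpa [hpq] using hp
    · by_cases h2 : z = q
      · subst h2; simpa [hpq.symm] using hq
      · simp [h1, h2]
  have h1 := reflTransGen_add (reflTransGen_single_four hpa) (reflTransGen_single_four hqb)
  have h2 := reflTransGen_add (reflTransGen_single_two haw) (reflTransGen_single_two hbw)
  rw [← Pi.single_add w] at h2
  exact .of_le hE ((h1.trans h2).trans (reflTransGen_single_two hwx)) (by simp)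

end Reaching

/-! ### Special graphs need four pebbles -/

section SpecialGraphs

variable {V : Type*} {H : SimpleGraph V}

theorem exists_common_neighbor_of_dist_eq_two {a b : V} (h : H.dist a b = 2) :
    ∃ m, H.Adj a m ∧ H.Adj m b := by
  obtain ⟨p, hp⟩ := SimpleGraph.exists_walk_of_dist_ne_zero (by omega : H.dist a b ≠ 0)
  rw [h] at hp
  match p, hp with
  | .cons h1 (.cons h2 .nil), _ => exact ⟨_, h1, h2⟩

theorem IsSpecial.dist_le_two (hH : IsSpecial H) (a b : V) : H.dist a b ≤ 2 := by
  have h := hH.diam_eq_two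
  rw [← h]
  -- An infinite extended diameter would give `diam = 0`.
  exact SimpleGraph.dist_le_diam (SimpleGraph.ediam_ne_top_of_diam_ne_zero (by omega))

theorem IsSpecial.connected (hH : IsSpecial H) : H.Connected := by
  have h := hH.diam_eq_two
  have : Nonempty V := ⟨hH.exists_specialPair.choose⟩
  exact SimpleGraph.connected_of_ediam_ne_top
    (SimpleGraph.ediam_ne_top_of_diam_ne_zero (by omega))

theorem IsSpecial.eq_or_adj_or_exists (hH : IsSpecial H) (a b : V) :
    a = b ∨ H.Adj a b ∨ ∃ m, H.Adj a m ∧ H.Adj m b := by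
  have h := hH.dist_le_two a b
  interval_cases hd : H.dist a b
  · exact .inl (hH.connected.dist_eq_zero_iff.mp hd)
  · exact .inr (.inl (SimpleGraph.dist_eq_one_iff_adj.mp hd))
  · exact .inr (.inr (exists_common_neighbor_of_dist_eq_two hd))

theorem IsSpecialPair.ne {u v : V} (h : IsSpecialPair H u v) : u ≠ v := by
  rintro rfl
  simpa using h.dist_eq_two

theorem IsSpecialPair.not_adj {u v : V} (h : IsSpecialPair H u v) : ¬ H.Adj u v := by
  intro h'
  have h1 := SimpleGraph.dist_eq_one_iff_adj.mpr h'
  have h2 := h.dist_eq_two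
  omega

open Classical in
/-- Four times the weight `2 ^ (-d)` of a vertex at distance `d` from `v`, with `d` cut off at `2`. -/
noncomputable def weight (H : SimpleGraph V) (v x : V) : ℕ :=
  if x = v then 4 else if H.Adj x v then 2 else 1

/-- The cut-off is harmless: only a step from weight 1 to weight 4 could fail, and neighbours of `v`
have weight 2. -/
theorem weight_le_two_mul {v x y : V} (h : H.Adj x y) : weight H v y ≤ 2 * weight H v x := by
  unfold weight
  split_ifs <;> simp_all

/-- A multiset of moves of `H`, with `f a b` moves from `a` to `b`, that starts from `E`, leaves no
vertex with a negative number of pebbles, and leaves a pebble on `x`. -/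
structure IsFlowTo [Fintype V] [DecidableEq V] (H : SimpleGraph V) (E : V → ℕ) (x : V)
    (f : V → V → ℕ) : Prop where
  adj : ∀ a b, f a b ≠ 0 → H.Adj a b
  balance : ∀ y, 2 * ∑ z, f y z + (if y = x then 1 else 0) ≤ E y + ∑ z, f z y

variable [Fintype V] [DecidableEq V]

/-- With at most three pebbles, a vertex can only be reached by at most two moves. -/
theorem IsFlowTo.cases_of_sum_le_three {E : V → ℕ} {x : V} {f : V → V → ℕ}
    (hf : IsFlowTo H E x f) (hE : ∑ y, E y ≤ 3) :
    1 ≤ E x ∨ (∃ a, 2 ≤ E a ∧ H.Adj a x) ∨ ∃ a c, 2 ≤ E a ∧ 1 ≤ E c ∧ H.Adj a c ∧ H.Adj c x := by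
  by_contra! hcon
  obtain ⟨hx, h1, h2⟩ := hcon
  -- Each move loses one pebble and one must remain, so three pebbles allow two moves. Tracing moves
  -- back from `x` would need a third.
  have hT : ∑ y, ∑ z, f z y ≤ 2 := by
    have h := Finset.sum_le_sum fun y (_ : y ∈ Finset.univ) => hf.balance y
    simp only [Finset.sum_add_distrib, ← Finset.mul_sum, Finset.sum_ite_eq',
      Finset.mem_univ, if_true] at h
    rw [Finset.sum_comm] at h
    omega
  have hsucc : ∀ y z, f y z ≠ 0 → 2 ≤ E y + ∑ w, f w y := by
    intro y z hyz
    have h := hf.balance y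
    have h' := Finset.single_le_sum (f := f y) (fun _ _ => Nat.zero_le _) (Finset.mem_univ z)
    omega
  have hpred : ∀ y, ∑ z, f z y ≠ 0 → ∃ z, f z y ≠ 0 := by
    intro y hy
    obtain ⟨z, -, hz⟩ := Finset.exists_ne_zero_of_sum_ne_zero hy
    exact ⟨z, hz⟩
  have hbx := hf.balance x
  rw [if_pos rfl] at hbx
  obtain ⟨y, hy⟩ := hpred x (by omega)
  have hyx := hf.adj _ _ hy
  have hy2 := hsucc y x hy
  have hEy : E y < 2 := by
    by_contra hc
    exact h1 y (by omega) hyx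
  obtain ⟨z, hz⟩ := hpred y (by omega)
  have hzy := hf.adj _ _ hz
  have hz2 := hsucc z y hz
  have hxy : ∑ w, f w x + ∑ w, f w y ≤ 2 := by
    refine le_trans ?_ hT
    rw [← Finset.sum_pair (f := fun y => ∑ w, f w y) hyx.ne']
    exact Finset.sum_le_sum_of_subset (Finset.subset_univ _)
  by_cases hzx : z = x
  · subst hzx
    omega
  have hxyz : ∑ w, f w z + (∑ w, f w x + ∑ w, f w y) ≤ 2 := by
    refine le_trans ?_ hT
    rw [← Finset.sum_pair (f := fun y => ∑ w, f w y) hyx.ne',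
      ← Finset.sum_insert (f := fun y => ∑ w, f w y) (by simp [hzx, hzy.ne])]
    exact Finset.sum_le_sum_of_subset (Finset.subset_univ _)
  exact h2 z y (by omega) (by omega) hzy hyx

theorem add_add_le_sum {E : V → ℕ} {a b c : V} (hab : a ≠ b) (hac : a ≠ c) (hbc : b ≠ c) :
    E a + E b + E c ≤ ∑ y, E y := by
  rw [add_assoc, ← Finset.sum_pair hbc, ← Finset.sum_insert (by simp [hab, hac])]
  exact Finset.sum_le_sum_of_subset (Finset.subset_univ _)

theorem add_le_sum {E : V → ℕ} {a b : V} (hab : a ≠ b) : E a + E b ≤ ∑ y, E y := by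
  rw [← Finset.sum_pair hab]
  exact Finset.sum_le_sum_of_subset (Finset.subset_univ _)

/-- Three pebbles do not suffice to reach every vertex of a special graph. -/
theorem IsSpecial.four_le_sum (hH : IsSpecial H) {E : V → ℕ}
    (hE : ∀ x, ∃ f, IsFlowTo H E x f) : 4 ≤ ∑ y, E y := by
  by_contra! hlt
  have hle : ∑ y, E y ≤ 3 := by omega
  have hcase := fun x => (hE x).choose_spec.cases_of_sum_le_three hle
  by_cases ha : ∃ a, 2 ≤ E a
  · obtain ⟨a, ha⟩ := ha
    have hone : ∀ b, b ≠ a → E b ≤ 1 := fun b hb => by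
      have := add_le_sum (E := E) hb
      omega
    have huniq : ∀ b, 2 ≤ E b → b = a := fun b hb => by
      by_contra hne
      have := hone b hne
      omega
    by_cases hc : ∃ c, c ≠ a ∧ 1 ≤ E c
    · obtain ⟨c, hca, hc⟩ := hc
      have hsupp : ∀ b, 1 ≤ E b → b = a ∨ b = c := fun b hb => by
        by_contra! hne
        have := add_add_le_sum (E := E) hca.symm hne.1.symm hne.2.symm
        omega
      by_cases hadj : H.Adj a c
      · refine hH.not_dominatingEdge ⟨a, c, hadj, fun x => ?_⟩
        rcases hcase x with h | ⟨b, hb, hbx⟩ | ⟨b, c', -, hc', -, hcx⟩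
        · exact .inl (hsupp x h)
        · exact .inr ⟨b, .inl (huniq b hb), hbx⟩
        · exact .inr ⟨c', hsupp c' hc', hcx⟩
      · obtain h | h | ⟨m, ham, hmc⟩ := hH.eq_or_adj_or_exists a c
        · exact hca h.symm
        · exact hadj h
        -- Since `a` and `c` are not adjacent, the single pebble on `c` cannot be doubled; it covers
        -- only `c`, which `m` dominates.
        refine hH.not_dominatingEdge ⟨a, m, ham, fun x => ?_⟩
        rcases hcase x with h | ⟨b, hb, hbx⟩ | ⟨b, c', hb, hc', hbc, hcx⟩
        · obtain rfl | rfl := hsupp x h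
          · exact .inl (.inl rfl)
          · exact .inr ⟨m, .inr rfl, hmc⟩
        · exact .inr ⟨b, .inl (huniq b hb), hbx⟩
        · obtain rfl := huniq b hb
          obtain rfl | rfl := hsupp c' hc'
          · exact (hbc.ne rfl).elim
          · exact (hadj hbc).elim
    · push Not at hc
      obtain ⟨b, hab⟩ : ∃ b, H.Adj a b := by
        obtain ⟨u, v, h⟩ := hH.exists_specialPair
        obtain ⟨b, hb⟩ : ∃ b, a ≠ b := by
          by_cases hau : a = u
          · exact ⟨v, hau ▸ h.ne⟩
          · exact ⟨u, hau⟩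
        obtain h | h | ⟨m, ham, -⟩ := hH.eq_or_adj_or_exists a b
        · exact (hb h).elim
        · exact ⟨b, h⟩
        · exact ⟨m, ham⟩
      have hsupp : ∀ b, 1 ≤ E b → b = a := fun b hb => by
        by_contra hne
        have := hc b hne
        omega
      refine hH.not_dominatingEdge ⟨a, b, hab, fun x => ?_⟩
      rcases hcase x with h | ⟨b, hb, hbx⟩ | ⟨b, c', -, hc', -, hcx⟩
      · exact .inl (.inl (hsupp x h))
      · exact .inr ⟨b, .inl (huniq b hb), hbx⟩
      · exact .inr ⟨c', .inl (hsupp c' hc'), hcx⟩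
  · push Not at ha
    -- No move is possible, so all vertices are occupied and there are at most three of them.
    have hpos : ∀ x, 1 ≤ E x := fun x => by
      rcases hcase x with h | ⟨b, hb, -⟩ | ⟨b, -, hb, -⟩
      · exact h
      · exact absurd hb (by have := ha b; omega)
      · exact absurd hb (by have := ha b; omega)
    obtain ⟨u, v, h⟩ := hH.exists_specialPair
    obtain ⟨m, hum, hmv⟩ := exists_common_neighbor_of_dist_eq_two h.dist_eq_two
    refine hH.not_dominatingEdge ⟨u, m, hum, fun x => ?_⟩
    by_contra! hx
    obtain ⟨hx1, hx2⟩ := hx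
    have hxu : x ≠ u := fun h => hx1 (.inl h)
    have hxm : x ≠ m := fun h => hx1 (.inr h)
    have hxv : x ≠ v := by
      rintro rfl
      exact hx2 m (.inr rfl) hmv
    have h3 : E x + (E u + E m + E v) ≤ ∑ y, E y := by
      rw [add_assoc, ← Finset.sum_pair hmv.ne,
        ← Finset.sum_insert (by simp [hum.ne, h.ne]),
        ← Finset.sum_insert (by simp [hxu, hxm, hxv])]
      exact Finset.sum_le_sum_of_subset (Finset.subset_univ _)
    have := hpos x
    have := hpos u
    have := hpos m
    have := hpos v
    omega

end SpecialGraphs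

/-! ### Chains: net-flow bounds and the periodic distribution -/

section Chain

variable {l : ℕ} {B : Fin l → Type*} {H : ∀ i, SimpleGraph (B i)} {u v : ∀ i, B i}

theorem PebblingMove.exists_balance {V : Type*} [DecidableEq V] {G : SimpleGraph V} {D D' : V → ℕ}
    (h : PebblingMove G D D') : ∃ p q, G.Adj p q ∧
      ∀ w, D w + (if w = q then 1 else 0) = D' w + 2 * (if w = p then 1 else 0) := by
  obtain ⟨a, b, hab, h1, h2, h3⟩ := h
  refine ⟨a, b, hab, fun w => ?_⟩
  by_cases hwa : w = a
  · subst hwa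
    rw [if_neg hab.ne, if_pos rfl]
    omega
  · by_cases hwb : w = b
    · subst hwb
      rw [if_neg hwa, if_pos rfl]
      omega
    · rw [if_neg hwa, if_neg hwb, h3 w hwa hwb]

theorem chain_adj_block {i : Fin l} {x y : B i} (h : (H i).Adj x y) :
    (chain H u v).Adj ⟨i, x⟩ ⟨i, y⟩ :=
  .block i x y h

section Bounds

variable [∀ i, Fintype (B i)]

/-- The weight of the pebbles of `D` in the block `n`, measured towards the vertex `t n`. -/
noncomputable def blockWeight (H : ∀ i, SimpleGraph (B i)) (D : (Σ i, B i) → ℕ) (t : ∀ i, B i)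
    (n : ℕ) : ℕ :=
  if h : n < l then ∑ x, D ⟨⟨n, h⟩, x⟩ * weight (H ⟨n, h⟩) (t ⟨n, h⟩) x else 0

/-- A bound for the net number of pebbles that enter the block `n` from the left. -/
noncomputable def rightBound (H : ∀ i, SimpleGraph (B i)) (D : (Σ i, B i) → ℕ) (v : ∀ i, B i) :
    ℕ → ℕ
  | 0 => 0
  | n + 1 => (blockWeight H D v n + rightBound H D v n) / 8

/-- A bound for the net number of pebbles that leave the block `l - k` to the left. -/
noncomputable def leftBoundAux (H : ∀ i, SimpleGraph (B i)) (D : (Σ i, B i) → ℕ) (u : ∀ i, B i) :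
    ℕ → ℕ
  | 0 => 0
  | k + 1 => (blockWeight H D u (l - (k + 1)) + leftBoundAux H D u k) / 8

/-- A bound for the net number of pebbles that leave the block `n` to the left. -/
noncomputable def leftBound (H : ∀ i, SimpleGraph (B i)) (D : (Σ i, B i) → ℕ) (u : ∀ i, B i)
    (n : ℕ) : ℕ :=
  leftBoundAux H D u (l - n)

theorem leftBound_last (D : (Σ i, B i) → ℕ) : leftBound H D u l = 0 := by
  simp [leftBound, leftBoundAux]

theorem leftBound_of_lt (D : (Σ i, B i) → ℕ) {n : ℕ} (hn : n < l) :
    leftBound H D u n = (blockWeight H D u n + leftBound H D u (n + 1)) / 8 := by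
  have h : l - n = (l - (n + 1)) + 1 := by omega
  have h' : l - (l - (n + 1) + 1) = n := by omega
  rw [leftBound, h, leftBoundAux, h', leftBound]

theorem blockWeight_apply (D : (Σ i, B i) → ℕ) (t : ∀ i, B i) (i : Fin l) :
    blockWeight H D t i = ∑ x, D ⟨i, x⟩ * weight (H i) (t i) x := by
  simp [blockWeight]

end Bounds

variable [∀ i, DecidableEq (B i)]

/-- Four pebbles on `v i` if `i` is divisible by three, and on `u i` if `i + 1` is. -/
def periodicDistribution (u v : ∀ i, B i) : (Σ i, B i) → ℕ := fun p =>
  (if p.2 = v p.1 then if (p.1 : ℕ) % 3 = 0 then 4 else 0 else 0) +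
    if p.2 = u p.1 then if (p.1 : ℕ) % 3 = 2 then 4 else 0 else 0

theorem four_le_periodicDistribution_right {i : Fin l} (hi : (i : ℕ) % 3 = 0) :
    4 ≤ periodicDistribution u v ⟨i, v i⟩ := by
  simp [periodicDistribution, hi]

theorem four_le_periodicDistribution_left {i : Fin l} (hi : (i : ℕ) % 3 = 2) :
    4 ≤ periodicDistribution u v ⟨i, u i⟩ := by
  simp [periodicDistribution, hi]

theorem reachable_of_four_le_block {D : (Σ i, B i) → ℕ} {i : Fin l} (hH : IsSpecial (H i))
    {a : B i} (ha : 4 ≤ D ⟨i, a⟩) (x : B i) : Reachable (chain H u v) D ⟨i, x⟩ := by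
  obtain rfl | h | ⟨m, h1, h2⟩ := hH.eq_or_adj_or_exists a x
  · exact reachable_of_two_le (by omega) (.inl rfl)
  · exact reachable_of_two_le (a := ⟨i, a⟩) (by omega) (.inr (chain_adj_block h))
  · exact reachable_of_four_le (b := ⟨i, m⟩) ha (chain_adj_block h1) (.inr (chain_adj_block h2))

theorem solvable_periodicDistribution (hH : ∀ i, IsSpecial (H i))
    (huv : ∀ i, IsSpecialPair (H i) (u i) (v i)) {k : ℕ} (hl : l = 3 * k) :
    Solvable (chain H u v) (periodicDistribution u v) := by
  rintro ⟨i, x⟩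
  have hi := i.2
  obtain h | h | h : (i : ℕ) % 3 = 0 ∨ (i : ℕ) % 3 = 2 ∨ (i : ℕ) % 3 = 1 := by omega
  · exact reachable_of_four_le_block (hH i) (four_le_periodicDistribution_right h) x
  · exact reachable_of_four_le_block (hH i) (four_le_periodicDistribution_left h) x
  · obtain ⟨j, hj⟩ : ∃ j : Fin l, (i : ℕ) = j + 1 := ⟨⟨i - 1, by omega⟩, by simp; omega⟩
    obtain ⟨j', hj'⟩ : ∃ j : Fin l, (j : ℕ) = i + 1 := ⟨⟨i + 1, by omega⟩, rfl⟩
    have h4 : 4 ≤ periodicDistribution u v ⟨j, v j⟩ :=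
      four_le_periodicDistribution_right (by omega)
    have h4' : 4 ≤ periodicDistribution u v ⟨j', u j'⟩ :=
      four_le_periodicDistribution_left (by omega)
    have hju : (chain H u v).Adj ⟨j, v j⟩ ⟨i, u i⟩ := .forward j i hj
    have hjv : (chain H u v).Adj ⟨j', u j'⟩ ⟨i, v i⟩ := .backward i j' hj'
    obtain hx | ⟨s, hs, hsx⟩ := (huv i).isDominatingSet x
    · obtain ⟨hx, -⟩ | rfl | rfl := hx
      · exact reachable_of_four_le h4 hju (.inr (chain_adj_block hx))
      · exact reachable_of_four_le h4 hju (.inl rfl)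
      · exact reachable_of_four_le h4' hjv (.inl rfl)
    · obtain ⟨hsu, hsv⟩ | rfl | rfl := hs
      · refine reachable_of_four_le_of_four_le ?_ h4 h4' hju hjv (w := ⟨i, s⟩)
          (chain_adj_block hsu) (chain_adj_block hsv) (chain_adj_block hsx)
        intro he
        have := congrArg (fun p : Σ i, B i => (p.1 : ℕ)) he
        dsimp only at this
        omega
      · exact reachable_of_four_le h4 hju (.inr (chain_adj_block hsx))
      · exact reachable_of_four_le h4' hjv (.inr (chain_adj_block hsx))

variable [∀ i, Fintype (B i)]

/-- The numbers of moves in a chain leading from `D` to `D'`: `f i a b` moves from `a` to `b` in the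
block `i`, and `R n` and `L n` moves to the right and to the left between the blocks `n - 1` and `n`. -/
structure IsChainFlow (H : ∀ i, SimpleGraph (B i)) (u v : ∀ i, B i) (D D' : (Σ i, B i) → ℕ)
    (f : ∀ i, B i → B i → ℕ) (R L : ℕ → ℕ) : Prop where
  adj : ∀ i a b, f i a b ≠ 0 → (H i).Adj a b
  -- Zero at both ends lets one `balance` equation serve the first and last blocks too.
  right_zero : R 0 = 0
  left_zero : L 0 = 0
  right_last : R l = 0
  left_last : L l = 0
  balance : ∀ i y, D ⟨i, y⟩ + ∑ z, f i z y + (if y = u i then R i else 0) +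
      (if y = v i then L (i + 1) else 0) =
    D' ⟨i, y⟩ + 2 * ∑ z, f i y z + 2 * (if y = u i then L i else 0) +
      2 * (if y = v i then R (i + 1) else 0)

theorem exists_isChainFlow {D D' : (Σ i, B i) → ℕ}
    (h : Relation.ReflTransGen (PebblingMove (chain H u v)) D D') :
    ∃ f R L, IsChainFlow H u v D D' f R L := by
  induction h with
  | refl => exact ⟨fun _ _ _ => 0, fun _ => 0, fun _ => 0, by simp, rfl, rfl, rfl, rfl, by simp⟩
  | tail _ hm ih =>
    obtain ⟨f, R, L, hf⟩ := ih
    obtain ⟨p, q, hpq, hbal⟩ := hm.exists_balance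
    obtain ⟨i, x, y, h⟩ | ⟨i, j, h⟩ | ⟨i, j, h⟩ := hpq
    · refine ⟨Function.update f i fun a b => f i a b + if a = x ∧ b = y then 1 else 0, R, L,
        fun j a b hab => ?_, hf.right_zero, hf.left_zero, hf.right_last, hf.left_last,
        fun j z => ?_⟩
      · by_cases hj : j = i
        · subst hj
          by_cases hxy : a = x ∧ b = y
          · rwa [hxy.1, hxy.2]
          · exact hf.adj _ _ _ (by simpa [hxy] using hab)
        · exact hf.adj _ _ _ (by simpa [hj] using hab)
      · have h1 := hbal ⟨j, z⟩
        have h2 := hf.balance j z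
        by_cases hj : j = i
        · subst hj
          have e1 : ∑ w, (if w = x ∧ z = y then 1 else 0) = if z = y then 1 else 0 := by
            by_cases hz : z = y <;> simp [hz]
          have e2 : ∑ w, (if z = x ∧ w = y then 1 else 0) = if z = x then 1 else 0 := by
            by_cases hz : z = x <;> simp [hz]
          simp only [Function.update_self, Finset.sum_add_distrib, e1, e2]
          simp only [Sigma.mk.injEq, heq_eq_eq, true_and] at h1
          omega
        · simp only [Function.update_of_ne hj]
          simp only [Sigma.mk.injEq, hj, false_and, if_false] at h1
          omega
    · refine ⟨f, fun n => R n + if n = j then 1 else 0, L, hf.adj, ?_, hf.left_zero, ?_,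
        hf.left_last, fun k z => ?_⟩
      · have := hf.right_zero
        simp only [this, zero_add, ite_eq_right_iff]
        omega
      · have := hf.right_last
        have := j.2
        simp only [hf.right_last, zero_add, ite_eq_right_iff]
        omega
      · have h1 := hbal ⟨k, z⟩
        have h2 := hf.balance k z
        have e1 : ((⟨k, z⟩ : Σ i, B i) = ⟨j, u j⟩) ↔ z = u k ∧ (k : ℕ) = j := by
          constructor
          · rintro ⟨⟩; exact ⟨rfl, rfl⟩
          · rintro ⟨rfl, hk⟩; obtain rfl := Fin.ext hk; rfl
        have e2 : ((⟨k, z⟩ : Σ i, B i) = ⟨i, v i⟩) ↔ z = v k ∧ (k : ℕ) + 1 = j := by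
          constructor
          · rintro ⟨⟩; exact ⟨rfl, h.symm⟩
          · rintro ⟨rfl, hk⟩
            obtain rfl : k = i := Fin.ext (by omega)
            rfl
        simp only [e1, e2, ite_and] at h1
        split_ifs at h1 h2 ⊢ <;> omega
    · refine ⟨f, R, fun n => L n + if n = j then 1 else 0, hf.adj, hf.right_zero, ?_,
        hf.right_last, ?_, fun k z => ?_⟩
      · have := hf.left_zero
        simp only [this, zero_add, ite_eq_right_iff]
        omega
      · have := j.2
        simp only [hf.left_last, zero_add, ite_eq_right_iff]
        omega
      · have h1 := hbal ⟨k, z⟩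
        have h2 := hf.balance k z
        have e1 : ((⟨k, z⟩ : Σ i, B i) = ⟨j, u j⟩) ↔ z = u k ∧ (k : ℕ) = j := by
          constructor
          · rintro ⟨⟩; exact ⟨rfl, rfl⟩
          · rintro ⟨rfl, hk⟩; obtain rfl := Fin.ext hk; rfl
        have e2 : ((⟨k, z⟩ : Σ i, B i) = ⟨i, v i⟩) ↔ z = v k ∧ (k : ℕ) + 1 = j := by
          constructor
          · rintro ⟨⟩; exact ⟨rfl, h.symm⟩
          · rintro ⟨rfl, hk⟩
            obtain rfl : k = i := Fin.ext (by omega)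
            rfl
        simp only [e1, e2, ite_and] at h1
        split_ifs at h1 h2 ⊢ <;> omega

/-- A move pays two pebbles for one of at most twice the weight, so it never gains weight. -/
theorem sum_mul_weight_le {V : Type*} [Fintype V] {G : SimpleGraph V} {f : V → V → ℕ}
    (hf : ∀ a b, f a b ≠ 0 → G.Adj a b) (t : V) :
    ∑ y, (∑ z, f z y) * weight G t y ≤ 2 * ∑ y, (∑ z, f y z) * weight G t y := by
  simp only [Finset.sum_mul, Finset.mul_sum]
  rw [Finset.sum_comm]
  refine Finset.sum_le_sum fun z _ => Finset.sum_le_sum fun y _ => ?_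
  by_cases h : f z y = 0
  · simp [h]
  · have := weight_le_two_mul (v := t) (hf z y h)
    calc f z y * weight G t y ≤ f z y * (2 * weight G t z) := Nat.mul_le_mul_left _ this
      _ = _ := by ring

theorem weight_self {V : Type*} (G : SimpleGraph V) (t : V) : weight G t t = 4 := by
  simp [weight]

theorem weight_eq_one {V : Type*} {G : SimpleGraph V} {t x : V} (h : x ≠ t) (h' : ¬ G.Adj x t) :
    weight G t x = 1 := by
  simp [weight, h, h']

/-- The balance of a chain flow in a block, weighted by the vicinity to a vertex. -/
theorem IsChainFlow.weight_balance {D D' : (Σ i, B i) → ℕ} {f : ∀ i, B i → B i → ℕ} {R L : ℕ → ℕ}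
    (hf : IsChainFlow H u v D D' f R L) (t : ∀ i, B i) (i : Fin l) :
    2 * L i * weight (H i) (t i) (u i) + 2 * R (i + 1) * weight (H i) (t i) (v i) ≤
      blockWeight H D t i + R i * weight (H i) (t i) (u i) +
        L (i + 1) * weight (H i) (t i) (v i) := by
  have h : ∑ y, _ = ∑ y, _ := Finset.sum_congr rfl fun y (_ : y ∈ Finset.univ) =>
    congrArg (· * weight (H i) (t i) y) (hf.balance i y)
  have h' := sum_mul_weight_le (hf.adj i) (t i)
  simp only [add_mul, Finset.sum_add_distrib, ite_mul, zero_mul, mul_assoc, mul_ite, mul_zero,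
    ← Finset.mul_sum, Finset.sum_ite_eq', Finset.mem_univ, if_true] at h
  rw [blockWeight_apply, mul_assoc, mul_assoc]
  omega

/-- Weighted towards `v`, a move out to the right costs 8 and a pebble arriving at `u` is worth 1,
since `u` and `v` are at distance two. This gives the division by 8 in `rightBound`. -/
theorem IsChainFlow.right_le {D D' : (Σ i, B i) → ℕ} {f : ∀ i, B i → B i → ℕ} {R L : ℕ → ℕ}
    (hf : IsChainFlow H u v D D' f R L) (huv : ∀ i, IsSpecialPair (H i) (u i) (v i)) :
    ∀ n ≤ l, R n ≤ L n + rightBound H D v n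
  | 0, _ => by simp [hf.right_zero]
  | n + 1, hn => by
    have ih := hf.right_le huv n (by omega)
    have h := hf.weight_balance v ⟨n, hn⟩
    rw [weight_self, weight_eq_one (huv _).ne (huv _).not_adj] at h
    rw [rightBound]
    dsimp only at h
    omega

theorem IsChainFlow.left_le {D D' : (Σ i, B i) → ℕ} {f : ∀ i, B i → B i → ℕ} {R L : ℕ → ℕ}
    (hf : IsChainFlow H u v D D' f R L) (huv : ∀ i, IsSpecialPair (H i) (u i) (v i)) {n : ℕ}
    (hn : n ≤ l) : L n ≤ R n + leftBound H D u n := by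
  induction hn using Nat.decreasingInduction with
  | self => simp [hf.left_last]
  | of_succ n hn ih =>
    have h := hf.weight_balance u ⟨n, hn⟩
    rw [weight_self, weight_eq_one (huv _).ne.symm fun h => (huv _).not_adj h.symm] at h
    rw [leftBound_of_lt D hn]
    dsimp only at h
    omega

theorem four_le_of_solvable {D : (Σ i, B i) → ℕ} (hD : Solvable (chain H u v) D)
    (hH : ∀ i, IsSpecial (H i)) (huv : ∀ i, IsSpecialPair (H i) (u i) (v i)) (i : Fin l) :
    4 ≤ ∑ x, D ⟨i, x⟩ + rightBound H D v i + leftBound H D u (i + 1) := by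
  have h := (hH i).four_le_sum
    (E := fun x => D ⟨i, x⟩ + (if x = u i then rightBound H D v i else 0) +
      if x = v i then leftBound H D u (i + 1) else 0) fun x => by
      obtain ⟨D', hDD', hx⟩ := hD ⟨i, x⟩
      obtain ⟨f, R, L, hf⟩ := exists_isChainFlow hDD'
      refine ⟨f i, hf.adj i, fun y => ?_⟩
      have h1 := hf.balance i y
      have h2 := hf.right_le huv i i.2.le
      have h3 := hf.left_le huv (n := i + 1) i.2
      have h4 : (if y = x then 1 else 0) ≤ D' ⟨i, y⟩ := by
        split_ifs with hyx
        · rwa [hyx]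
        · exact Nat.zero_le _
      split_ifs at h1 h4 ⊢ <;> omega
  simpa [Finset.sum_add_distrib] using h

/-- For total at least 5 the inequality survives dropping the floors; total 4 needs integrality. -/
theorem eight_add_div_le {p q r a b P Q : ℕ} (h : 4 ≤ p + q + r + a + b)
    (hP : P ≤ 4 * p + q + 2 * r) (hQ : Q ≤ p + 4 * q + 2 * r) :
    8 + 2 * ((P + a) / 8) + 2 * ((Q + b) / 8) ≤ 3 * (p + q + r) + 2 * a + 2 * b := by
  have hX := Nat.div_mul_le_self (P + a) 8
  have hY := Nat.div_mul_le_self (Q + b) 8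
  generalize (P + a) / 8 = X at *
  generalize (Q + b) / 8 = Y at *
  by_contra hlt
  have hsum : p + q + r + a + b ≤ 4 := by omega
  have hX4 : X ≤ 2 := by omega
  have hY4 : Y ≤ 2 := by omega
  interval_cases X <;> interval_cases Y <;> omega

theorem bound_le_of_solvable {D : (Σ i, B i) → ℕ} (hD : Solvable (chain H u v) D)
    (hH : ∀ i, IsSpecial (H i)) (huv : ∀ i, IsSpecialPair (H i) (u i) (v i)) (i : Fin l) :
    8 + 2 * rightBound H D v (i + 1) + 2 * leftBound H D u i ≤
      3 * ∑ x, D ⟨i, x⟩ + 2 * rightBound H D v i + 2 * leftBound H D u (i + 1) := by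
  have h4 := four_le_of_solvable hD hH huv i
  have hsp := huv i
  rw [leftBound_of_lt D i.2, rightBound, blockWeight_apply, blockWeight_apply]
  set d := ∑ x, D ⟨i, x⟩ with hd
  have key : ∃ p q r, d = p + q + r ∧
      ∑ x, D ⟨i, x⟩ * weight (H i) (v i) x ≤ 4 * p + q + 2 * r ∧
      ∑ x, D ⟨i, x⟩ * weight (H i) (u i) x ≤ p + 4 * q + 2 * r := by
    -- Pebbles on `v i`, on `u i`, and elsewhere; the last have weight at most 2 towards either.
    refine ⟨∑ x, D ⟨i, x⟩ * (if x = v i then 1 else 0), ∑ x, D ⟨i, x⟩ * (if x = u i then 1 else 0),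
      ∑ x, D ⟨i, x⟩ * (if x = v i then 0 else if x = u i then 0 else 1), ?_, ?_, ?_⟩
    · rw [hd, ← Finset.sum_add_distrib, ← Finset.sum_add_distrib]
      refine Finset.sum_congr rfl fun x _ => ?_
      rw [← mul_add, ← mul_add]
      have := hsp.ne
      split_ifs <;> simp_all
    · rw [Finset.mul_sum, Finset.mul_sum, ← Finset.sum_add_distrib, ← Finset.sum_add_distrib]
      refine Finset.sum_le_sum fun x _ => ?_
      rw [mul_left_comm 4, mul_left_comm 2, ← mul_add, ← mul_add]
      refine Nat.mul_le_mul_left _ ?_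
      have := hsp.ne
      have := hsp.not_adj
      unfold weight
      split_ifs <;> simp_all
    · rw [Finset.mul_sum, Finset.mul_sum, ← Finset.sum_add_distrib, ← Finset.sum_add_distrib]
      refine Finset.sum_le_sum fun x _ => ?_
      rw [mul_left_comm 4, mul_left_comm 2, ← mul_add, ← mul_add]
      refine Nat.mul_le_mul_left _ ?_
      have := hsp.ne
      have := hsp.not_adj
      have := mt SimpleGraph.Adj.symm hsp.not_adj
      unfold weight
      split_ifs <;> simp_all
  obtain ⟨p, q, r, h1, h2, h3⟩ := key
  rw [h1] at h4 ⊢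
  exact eight_add_div_le h4 h2 h3

theorem eight_mul_le_of_solvable {D : (Σ i, B i) → ℕ} (hD : Solvable (chain H u v) D)
    (hH : ∀ i, IsSpecial (H i)) (huv : ∀ i, IsSpecialPair (H i) (u i) (v i)) :
    8 * l ≤ 3 * ∑ p, D p := by
  have h := Finset.sum_le_sum fun i (_ : i ∈ Finset.univ) => bound_le_of_solvable hD hH huv i
  simp only [Finset.sum_add_distrib, ← Finset.mul_sum, Finset.sum_const, Finset.card_univ,
    Fintype.card_fin, smul_eq_mul] at h
  rw [Fintype.sum_sigma]
  have hr0 : rightBound H D v 0 = 0 := rfl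
  have hl := leftBound_last (H := H) (u := u) D
  -- Telescoping: the incoming bounds vanish at the two ends, and the outgoing ones left over are
  -- nonnegative and dropped.
  have e1 := Finset.sum_range_succ (rightBound H D v) l
  have e2 := Finset.sum_range_succ' (rightBound H D v) l
  have e3 := Finset.sum_range_succ (leftBound H D u) l
  have e4 := Finset.sum_range_succ' (leftBound H D u) l
  rw [Fin.sum_univ_eq_sum_range (fun n => rightBound H D v (n + 1)),
    Fin.sum_univ_eq_sum_range (fun n => leftBound H D u (n + 1)),
    Fin.sum_univ_eq_sum_range (rightBound H D v),
    Fin.sum_univ_eq_sum_range (leftBound H D u)] at h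
  omega

theorem sum_periodicDistribution {k : ℕ} (hl : l = 3 * k) :
    ∑ p, periodicDistribution u v p = 8 * k := by
  simp only [Fintype.sum_sigma, periodicDistribution, Finset.sum_add_distrib,
    Finset.sum_ite_eq', Finset.mem_univ, if_true]
  rw [← Finset.sum_add_distrib, Fin.sum_univ_eq_sum_range
    (fun n => (if n % 3 = 0 then 4 else 0) + if n % 3 = 2 then 4 else 0), hl]
  clear hl
  induction k with
  | zero => rfl
  | succ k ih =>
    rw [Nat.mul_succ, Finset.sum_range_succ, Finset.sum_range_succ, Finset.sum_range_succ, ih]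
    simp [Nat.add_mod]
    omega

end Chain

end Pebbling

theorem mainTheorem4 {l : ℕ} {B : Fin l → Type*} [∀ i, Fintype (B i)]
    (H : ∀ i, SimpleGraph (B i)) (hH : ∀ i, Pebbling.IsSpecial (H i))
    (u v : ∀ i, B i) (huv : ∀ i, Pebbling.IsSpecialPair (H i) (u i) (v i)) :
    (8 / 3 : ℝ) * (l : ℝ) ≤ (Pebbling.optimalPebblingNumber (Pebbling.chain H u v) : ℝ) ∧
      ∀ k : ℕ, l = 3 * k →
        Pebbling.optimalPebblingNumber (Pebbling.chain H u v) = 8 * k := by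
  classical
  have hopt := Pebbling.optimalPebblingNumber_isLeast (Pebbling.chain H u v)
  obtain ⟨D, hD, hDsum⟩ := hopt.1
  have hlow := Pebbling.eight_mul_le_of_solvable hD hH huv
  rw [hDsum] at hlow
  refine ⟨?_, fun k hk => le_antisymm ?_ (by omega)⟩
  · have : (8 * l : ℝ) ≤ 3 * (Pebbling.optimalPebblingNumber (Pebbling.chain H u v) : ℝ) := by
      exact_mod_cast hlow
    linarith
  · exact hopt.2 ⟨_, Pebbling.solvable_periodicDistribution hH huv hk,
      Pebbling.sum_periodicDistribution hk⟩
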